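/- For a positive integer $p$ let $$\Gamma_0^*(p)=\Gamma_0(p)\cup\Gamma_0(p)W_p,\qquad W_p=\begin{pmatrix}0&-1/\sqrt p\\ \sqrt p&0\end{pmatrix},$$ where $\Gamma_0(p)\subset \mathrm{SL}_2(\mathbb Z)$ is the subgroup of matrices whose lower left entry is divisible by $p$. For an even integer $k\ge 4$ let $M_{k,3}$ be the space of modular forms of weight $k$ for $\Gamma_0^*(3)$, that is, of functions that are holomorphic on the upper half plane $\mathbb H$ and at the cusps, and transform with weight $k$ under $\Gamma_0^*(3)$. For $z\in\mathbb H$ let $$E_k(z)=\frac12\sum_{\substack{(c,d)\in\mathbb Z^2\\ \gcd(c,d)=1}}(cz+d)^{-k},\qquad E^*_{k,3}(z)=\frac{1}{3^{k/2}+1}\left(3^{k/2}E_k(3z)+E_k(z)\right).$$ Let $v_z(f)\in\{0,1,2,\dots\}\cup\{\infty\}$ be the order of vanishing of $f$ at $z\in\mathbb H$ (with $v_z(0)=\infty$), and let $\rho_3=e^{i(5\pi/6)}/\sqrt3$. Proposition. Let $k\ge 4$ be an even integer, let $s_k\in\{0,1\}$ be such that $2s_k\equiv k\pmod 4$, and let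 $t_k\in\{0,1,2,3,4,5\}$ be such that $-2t_k\equiv k\pmod{12}$. Then every $f\in M_{k,3}$ satisfies $$v_{i/\sqrt3}(f)\ge s_k\qquad\text{and}\qquad v_{\rho_3}(f)\ge t_k .$$ If $f$ is a nonzero constant multiple of $E^*_{k,3}$, then both inequalities are equalities. -/

import Mathlib

noncomputable section

namespace Fricke

open UpperHalfPlane CongruenceSubgroup Matrix.SpecialLinearGroup
open scoped MatrixGroups

/-- The Fricke involution `W_p = (0, -1/√p; √p, 0)`, as an element of `GL(2, ℝ)`
(it has determinant one). -/
def W (p : ℕ) [NeZero p] : GL (Fin 2) ℝ :=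
  Matrix.GeneralLinearGroup.mkOfDetNeZero !![0, -1 / √(p : ℝ); √(p : ℝ), 0] (by
    have hp : √(p : ℝ) ≠ 0 := by
      have : (0 : ℝ) < p := by exact_mod_cast Nat.pos_of_ne_zero (NeZero.ne p)
      positivity
    rw [Matrix.det_fin_two_of]
    field_simp
    norm_num)

/-- Conjugation by `W_p` preserves `Γ₀(p)`. -/
lemma W_mul_Gamma0 (p : ℕ) [NeZero p] {γ : SL(2, ℤ)} (hγ : γ ∈ Gamma0 p) :
    ∃ γ' ∈ Gamma0 p, W p * mapGL ℝ γ = mapGL ℝ γ' * W p := by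
  have hp0 : (0 : ℝ) < p := by exact_mod_cast Nat.pos_of_ne_zero (NeZero.ne p)
  have hp : √(p : ℝ) ≠ 0 := by positivity
  rw [Gamma0_mem, ZMod.intCast_zmod_eq_zero_iff_dvd] at hγ
  obtain ⟨c, hc⟩ := hγ
  have hdet := γ.det_coe
  rw [Matrix.det_fin_two] at hdet
  obtain ⟨γ', h00, h01, h10, h11⟩ : ∃ γ' : SL(2, ℤ), γ' 0 0 = γ 1 1 ∧ γ' 0 1 = -c ∧
      γ' 1 0 = -(p * γ 0 1) ∧ γ' 1 1 = γ 0 0 := by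
    refine ⟨⟨!![γ.1 1 1, -c; -(p * γ.1 0 1), γ.1 0 0], ?_⟩, rfl, rfl, rfl, rfl⟩
    rw [Matrix.det_fin_two_of]
    rw [hc] at hdet
    linear_combination hdet
  refine ⟨γ', ?_, ?_⟩
  · rw [Gamma0_mem, h10]
    simp
  · have hc' : (γ 1 0 : ℝ) = p * c := by exact_mod_cast hc
    ext i j
    fin_cases i <;> fin_cases j <;>
      simp [W, Matrix.mul_apply, Fin.sum_univ_two, hc', Matrix.GeneralLinearGroup.mkOfDetNeZero,
        h00, h01, h10, h11] <;> field_simp <;>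
      (try rw [Real.sq_sqrt hp0.le]) <;> (try ring)

/-- `W_p² = -1` lies in `Γ₀(p)`. -/
lemma W_mul_W (p : ℕ) [NeZero p] : W p * W p = mapGL ℝ (-1 : SL(2, ℤ)) := by
  have hp0 : (0 : ℝ) < p := by exact_mod_cast Nat.pos_of_ne_zero (NeZero.ne p)
  have hp : √(p : ℝ) ≠ 0 := by positivity
  ext i j
  fin_cases i <;> fin_cases j <;>
    simp [W, Matrix.mul_apply, Fin.sum_univ_two, Matrix.GeneralLinearGroup.mkOfDetNeZero] <;> field_simp

lemma neg_one_mem (p : ℕ) : (-1 : SL(2, ℤ)) ∈ Gamma0 p := by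
  rw [Gamma0_mem]; simp

/-- The Fricke group `Γ₀*(p) = Γ₀(p) ∪ Γ₀(p) W_p`, as a subgroup of `GL(2, ℝ)`. -/
def Gamma0Star (p : ℕ) [NeZero p] : Subgroup (GL (Fin 2) ℝ) where
  carrier := {g | ∃ γ ∈ Gamma0 p, g = mapGL ℝ γ} ∪ {g | ∃ γ ∈ Gamma0 p, g = mapGL ℝ γ * W p}
  one_mem' := Or.inl ⟨1, one_mem _, by simp⟩
  mul_mem' := by
    rintro _ _ (⟨a, ha, rfl⟩ | ⟨a, ha, rfl⟩) (⟨b, hb, rfl⟩ | ⟨b, hb, rfl⟩)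
    · exact Or.inl ⟨a * b, mul_mem ha hb, by simp⟩
    · exact Or.inr ⟨a * b, mul_mem ha hb, by simp [mul_assoc]⟩
    · obtain ⟨b', hb', h⟩ := W_mul_Gamma0 p hb
      exact Or.inr ⟨a * b', mul_mem ha hb', by rw [mul_assoc, h, map_mul, mul_assoc]⟩
    · obtain ⟨b', hb', h⟩ := W_mul_Gamma0 p hb
      refine Or.inl ⟨a * b' * -1, mul_mem (mul_mem ha hb') (neg_one_mem p), ?_⟩
      rw [map_mul, map_mul, ← W_mul_W p, mul_assoc, ← mul_assoc (W p), h]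
      simp only [mul_assoc]
  inv_mem' := by
    rintro _ (⟨a, ha, rfl⟩ | ⟨a, ha, rfl⟩)
    · exact Or.inl ⟨a⁻¹, inv_mem ha, by simp⟩
    · obtain ⟨b, hb, h⟩ := W_mul_Gamma0 p (inv_mem ha)
      refine Or.inr ⟨-1 * b, mul_mem (neg_one_mem p) hb, ?_⟩
      have h1 : mapGL ℝ (-1 : SL(2, ℤ)) * mapGL ℝ (-1 : SL(2, ℤ)) = 1 := by
        rw [← map_mul]; simp
      have h2 : W p * (mapGL ℝ (-1 : SL(2, ℤ)) * W p) = 1 := by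
        rw [← h1, ← W_mul_W p]; simp only [mul_assoc]
      rw [inv_eq_iff_mul_eq_one, map_mul, mul_assoc (mapGL ℝ (-1 : SL(2, ℤ))), ← h,
        mul_assoc (mapGL ℝ a), ← mul_assoc (mapGL ℝ (-1 : SL(2, ℤ))), ← mul_assoc (W p), h2,
        one_mul, ← map_mul, mul_inv_cancel, map_one]

/-- `M_{k,p}`: the modular forms of weight `k` for `Γ₀*(p)`, holomorphic on `ℍ` and at the cusps. -/
abbrev M (k : ℤ) (p : ℕ) [NeZero p] : Type := ModularForm (Gamma0Star p) k

/-- The point `p z` of the upper half plane. -/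
def scale (p : ℕ) [NeZero p] (z : ℍ) : ℍ :=
  ⟨(p : ℂ) * z, by
    have hp : (0 : ℝ) < p := by exact_mod_cast Nat.pos_of_ne_zero (NeZero.ne p)
    simpa using mul_pos hp z.im_pos⟩

/-- The Eisenstein series `E*_{k,p}(z) = (p^{k/2} E_k(pz) + E_k(z)) / (p^{k/2} + 1)` for `Γ₀*(p)`.
Here `ModularForm.E` is `E_k(z) = (1/2) ∑_{(c,d)=1} (c z + d)^{-k}`. The weight `k` is even
wherever this is used, so `k / 2` is exact. -/
def EStar {k : ℕ} (hk : 3 ≤ k) (p : ℕ) [NeZero p] (z : ℍ) : ℂ :=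
  1 / ((p : ℂ) ^ (k / 2) + 1) *
    ((p : ℂ) ^ (k / 2) * ModularForm.E hk (scale p z) + ModularForm.E hk z)

/-- The order of vanishing `v_z(f)` of `f : ℍ → ℂ` at `z` (equal to `⊤` when `f` vanishes
identically near `z`). -/
def ord (z : ℍ) (f : ℍ → ℂ) : ℕ∞ :=
  analyticOrderAt (fun w : ℂ => f (ofComplex w)) (z : ℂ)

/-- The point `i / √3`. -/
def iDivSqrtThree : ℍ :=
  ⟨Complex.I / ((√3 : ℝ) : ℂ), by rw [Complex.div_ofReal_im, Complex.I_im]; positivity⟩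

/-- The point `ρ₃ = e^{i (5π/6)} / √3`. -/
def rhoThree : ℍ :=
  ⟨Complex.exp (Complex.I * (5 * (Real.pi : ℂ) / 6)) / ((√3 : ℝ) : ℂ), by
    have h : Complex.I * (5 * (Real.pi : ℂ) / 6) = ((5 * Real.pi / 6 : ℝ) : ℂ) * Complex.I := by
      push_cast; ring
    rw [h, Complex.div_ofReal_im, Complex.exp_ofReal_mul_I_im]
    have := Real.sin_pos_of_pos_of_lt_pi (x := 5 * Real.pi / 6)
      (by positivity) (by linarith [Real.pi_pos])
    positivity⟩

end Fricke

end

/-! ### Transformation laws and the local constraint at a fixed point -/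

namespace Fricke
open UpperHalfPlane CongruenceSubgroup Matrix.SpecialLinearGroup Filter Topology
open scoped MatrixGroups ModularForm

/-! Both points are fixed by a map `z ↦ -1/(3z) - a` coming from the Fricke group, with `a = 0` for
`i/√3` and `a = 1` for `ρ₃`. Under it `f` picks up the factor `(√3 z)^k`. Since the derivative at
the fixed point `z₀` is `(√3 z₀)^(-2)`, comparing leading Taylor coefficients for a zero of finite
order `m` gives `(√3 z₀)^(k+2m) = 1` (`pow_eq_one_of_transform`). As `√3 z₀` is a primitive root of
unity of order `N = 4` resp. `N = 12`, this says `N ∣ k + 2m`, and the least such `m` is `s_k` resp.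
`t_k`. This proves the lower bounds.

For equality no valence formula is used; the Taylor coefficient of index `t` is shown to be nonzero
directly. In the disc coordinate `u` with `w = (z - z̄u)/(1-u)`, the `u^n` coefficient of
`(1-u)^(-k) E_k(w)` is a positive multiple of `S_n(z) = ∑ v̄^n / v^(k+n)`, where `v = cz + d` with
`c`, `d` coprime (`hasSum_E_disc`). For `E*` the coefficient is therefore a positive multiple of
`3^(k/2) S_t(3z₀) + S_t(z₀)`. Swapping `c` and `d` gives `S_t(z₀) = 3^(k/2)` times the conjugate of
`S_t(3z₀)` (`coprimeSum_eq_conj`), so it remains to see that `Re S_t(3z₀) > 0`. The lattice `ℤ·3z₀ +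
ℤ` has norm form `3x² + y²` resp. `x² - xy + y²` in a suitable basis. Its vectors of norm 1
contribute exactly 1 each because `N ∣ k + 2t`, and they outweigh all the others
(`re_tsum_pos_of_box`). -/

lemma sqrt_three_sq : ((√3 : ℝ) : ℂ) ^ 2 = 3 := by
  rw [← Complex.ofReal_pow, Real.sq_sqrt (by norm_num)]; norm_num

lemma sqrt_three_ne_zero : ((√3 : ℝ) : ℂ) ≠ 0 := by simp

/-- Transformation under `z ↦ -1 / (3 z) - a` around a fixed point `z₀` restricts the order of
vanishing at `z₀`. -/
lemma pow_eq_one_of_transform {g : ℂ → ℂ} {z₀ a : ℂ} {k m : ℕ} (hz₀ : z₀ ≠ 0)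
    (hfix : -1 / (3 * z₀) - a = z₀) (hg : AnalyticAt ℂ g z₀)
    (htr : ∀ᶠ z in 𝓝 z₀, g (-1 / (3 * z) - a) = (((√3 : ℝ) : ℂ) * z) ^ k * g z)
    (hm : analyticOrderAt g z₀ = m) :
    (((√3 : ℝ) : ℂ) * z₀) ^ (k + 2 * m) = 1 := by
  obtain ⟨h, hh, hh0, hgh⟩ := hg.analyticOrderAt_eq_natCast.1 hm
  have h3 := sqrt_three_sq
  have hφ : ContinuousAt (fun z : ℂ => -1 / (3 * z) - a) z₀ := by
    have : (3 : ℂ) * z₀ ≠ 0 := by simpa using hz₀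
    fun_prop (disch := assumption)
  have hφt : Tendsto (fun z : ℂ => -1 / (3 * z) - a) (𝓝 z₀) (𝓝 z₀) := by
    have := hφ.tendsto
    rwa [hfix] at this
  have hne : ∀ᶠ z in 𝓝 z₀, z ≠ 0 := isOpen_ne.mem_nhds hz₀
  have key : ∀ᶠ z in 𝓝[≠] z₀, h (-1 / (3 * z) - a) =
      (((√3 : ℝ) : ℂ) * z) ^ k * (3 * z * z₀) ^ m * h z := by
    filter_upwards [htr.filter_mono nhdsWithin_le_nhds, hgh.filter_mono nhdsWithin_le_nhds,
      (hφt.eventually hgh).filter_mono nhdsWithin_le_nhds, hne.filter_mono nhdsWithin_le_nhds,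
      self_mem_nhdsWithin] with z h1 h2 h3 h4 h5
    rw [h2, h3] at h1
    -- Subtracting the fixed-point equation makes the displacement an exact multiple of `z - z₀`.
    -- Its `m`-th power then cancels for `z ≠ z₀`, and `z → z₀` compares the values of `h` at `z₀`.
    have hsub : -1 / (3 * z) - a - z₀ = (z - z₀) / (3 * z * z₀) := by
      nth_rewrite 1 [← hfix]
      field_simp
      ring
    have h5' : z - z₀ ≠ 0 := sub_ne_zero.2 h5
    rw [hsub, div_pow] at h1
    simp only [smul_eq_mul] at h1
    have hz : (3 * z * z₀) ^ m ≠ 0 := pow_ne_zero _ (by simp [h4, hz₀])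
    have hd : (z - z₀) ^ m ≠ 0 := pow_ne_zero _ h5'
    rw [div_mul_eq_mul_div, div_eq_iff hz] at h1
    apply mul_left_cancel₀ hd
    rw [h1]; ring
  have hl : Tendsto (fun z => h (-1 / (3 * z) - a)) (𝓝[≠] z₀) (𝓝 (h z₀)) :=
    (hh.continuousAt.tendsto.comp hφt).mono_left nhdsWithin_le_nhds
  have hr : Tendsto (fun z => (((√3 : ℝ) : ℂ) * z) ^ k * (3 * z * z₀) ^ m * h z) (𝓝[≠] z₀)
      (𝓝 ((((√3 : ℝ) : ℂ) * z₀) ^ k * (3 * z₀ * z₀) ^ m * h z₀)) := by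
    have hc := hh.continuousAt
    have : ContinuousAt (fun z => (((√3 : ℝ) : ℂ) * z) ^ k * (3 * z * z₀) ^ m * h z) z₀ := by
      fun_prop
    exact this.tendsto.mono_left nhdsWithin_le_nhds
  have heq := tendsto_nhds_unique hl (hr.congr' (key.mono fun _ h => h.symm))
  have : (((√3 : ℝ) : ℂ) * z₀) ^ k * (3 * z₀ * z₀) ^ m = 1 :=
    mul_right_cancel₀ hh0 (by rw [one_mul]; exact heq.symm)
  rw [← this, pow_add, pow_mul, mul_pow _ z₀ 2, h3]
  ring

/-- The point `-1 / (3 z)`. -/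
noncomputable def invThree (z : ℍ) : ℍ :=
  ⟨-1 / (3 * (z : ℂ)), by
    have h : -1 / (3 * (z : ℂ)) = ((1 / 3 : ℝ) : ℂ) * (-(z : ℂ))⁻¹ := by
      have := z.ne_zero
      push_cast
      field_simp
    rw [h, Complex.im_ofReal_mul]
    exact mul_pos (by norm_num) z.im_inv_neg_coe_pos⟩

/-- Only invariance under the translation and the Fricke involution is needed. The argument thus
applies to `EStar` as a bare function, without building it as a modular form. -/
lemma transform_of_invariant {f : ℍ → ℂ} {k : ℕ}
    (hT : ∀ z : ℍ, f ((1 : ℝ) +ᵥ z) = f z)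
    (hW : ∀ z : ℍ, f (invThree z) = (((√3 : ℝ) : ℂ) * z) ^ k * f z) (z₀ : ℍ)
    {a : ℕ} :
    ∀ᶠ z in 𝓝 (z₀ : ℂ), (f ∘ ofComplex) (-1 / (3 * z) - (a : ℂ)) =
      (((√3 : ℝ) : ℂ) * z) ^ k * (f ∘ ofComplex) z := by
  have hTa : ∀ (a : ℕ) (z : ℍ), f ((-(a : ℝ)) +ᵥ z) = f z := by
    intro a
    induction a with
    | zero => intro z; simp
    | succ n ih =>
      intro z
      rw [← ih z, ← hT ((-((n + 1 : ℕ) : ℝ)) +ᵥ z), vadd_vadd]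
      congr 2
      push_cast; ring
  filter_upwards [isOpen_upperHalfPlaneSet.mem_nhds z₀.im_pos] with z hz
  have h1 : ofComplex z = ⟨z, hz⟩ := ofComplex_apply_of_im_pos hz
  have h2 : ((((-(a : ℝ)) +ᵥ invThree ⟨z, hz⟩ : ℍ)) : ℂ) = -1 / (3 * z) - (a : ℂ) := by
    rw [coe_vadd]
    simp [invThree]
    ring
  simp only [Function.comp]
  rw [← h2, ofComplex_apply, hTa, hW, h1]

lemma apply_eq_of_slash_eq {f : ℍ → ℂ} {k : ℕ} {g : GL (Fin 2) ℝ} (hdet : g.det.val = 1)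
    (hf : f ∣[(k : ℤ)] g = f) {z w : ℍ} (hw : (w : ℂ) = num g z / denom g z) :
    f w = denom g z ^ k * f z := by
  have hgz : g • z = w := by
    ext
    rw [coe_smul_of_det_pos (by rw [hdet]; norm_num), hw]
  have h := congrFun hf z
  rw [ModularForm.slash_apply, hgz, hdet, σ, if_pos (by rw [hdet]; norm_num)] at h
  rw [← h, zpow_neg, zpow_natCast]
  have := pow_ne_zero k (denom_ne_zero g z)
  field_simp
  simp

lemma det_mapGL (γ : SL(2, ℤ)) : (mapGL ℝ γ).det.val = 1 := by simp

lemma E_vadd_one {k : ℕ} (hk : 3 ≤ k) (z : ℍ) :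
    ModularForm.E hk ((1 : ℝ) +ᵥ z) = ModularForm.E hk z := by
  have h := SlashInvariantForm.slash_action_eqn (ModularForm.E hk)
    (mapGL ℝ ModularGroup.T) (Set.mem_range_self _)
  have := apply_eq_of_slash_eq (det_mapGL _) h (z := z) (w := (1 : ℝ) +ᵥ z)
    (by simp [num, denom, ModularGroup.coe_T, add_comm])
  simpa [denom, ModularGroup.coe_T] using this

lemma E_S {k : ℕ} (hk : 3 ≤ k) (z w : ℍ) (h : (w : ℂ) = -1 / z) :
    ModularForm.E hk w = (z : ℂ) ^ k * ModularForm.E hk z := by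
  have h' := SlashInvariantForm.slash_action_eqn (ModularForm.E hk)
    (mapGL ℝ ModularGroup.S) (Set.mem_range_self _)
  have := apply_eq_of_slash_eq (det_mapGL _) h' (z := z) (w := w)
    (by simp [num, denom, ModularGroup.coe_S, h])
  simpa [denom, ModularGroup.coe_S] using this

lemma M_vadd_one {k : ℕ} (f : M k 3) (z : ℍ) : f ((1 : ℝ) +ᵥ z) = f z := by
  have h := SlashInvariantForm.slash_action_eqn f
    (mapGL ℝ ModularGroup.T) (Or.inl ⟨ModularGroup.T, by rw [Gamma0_mem]; rfl, rfl⟩)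
  have := apply_eq_of_slash_eq (det_mapGL _) h (z := z) (w := (1 : ℝ) +ᵥ z)
    (by simp [num, denom, ModularGroup.coe_T, add_comm])
  simpa [denom, ModularGroup.coe_T] using this

lemma M_invThree {k : ℕ} (f : M k 3) (z : ℍ) :
    f (invThree z) = (((√3 : ℝ) : ℂ) * z) ^ k * f z := by
  have h := SlashInvariantForm.slash_action_eqn f (W 3) (Or.inr ⟨1, one_mem _, by simp⟩)
  have hdet : (W 3).det.val = 1 := by
    simp [W, Matrix.GeneralLinearGroup.mkOfDetNeZero, Matrix.det_fin_two_of]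
  have := apply_eq_of_slash_eq hdet h (z := z) (w := invThree z) (by
    have h3 := sqrt_three_sq
    have h0 := sqrt_three_ne_zero
    have hz := z.ne_zero
    simp only [num, denom, W, Matrix.GeneralLinearGroup.mkOfDetNeZero, invThree]
    simp
    field_simp
    rw [h3])
  simpa [denom, W, Matrix.GeneralLinearGroup.mkOfDetNeZero] using this

lemma EStar_vadd_one {k : ℕ} (hk : 3 ≤ k) (z : ℍ) :
    EStar hk 3 ((1 : ℝ) +ᵥ z) = EStar hk 3 z := by
  have h : scale 3 ((1 : ℝ) +ᵥ z) = (1 : ℝ) +ᵥ ((1 : ℝ) +ᵥ ((1 : ℝ) +ᵥ scale 3 z)) := by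
    ext
    simp [scale]
    ring
  rw [EStar, EStar, h]
  simp only [E_vadd_one]

/-- The involution exchanges the two summands: `3 · (-1/(3z)) = -1/z`, while `-1/(3z)` is the image
of `3z` under `S`. Evenness of `k` identifies `√3^k` with `3^(k/2)`. -/
lemma EStar_invThree {k : ℕ} (hk : 3 ≤ k) (he : Even k) (z : ℍ) :
    EStar hk 3 (invThree z) = (((√3 : ℝ) : ℂ) * z) ^ k * EStar hk 3 z := by
  have hz := z.ne_zero
  rw [EStar, EStar, E_S hk z (scale 3 (invThree z)) (by simp [scale, invThree]; field_simp),
    E_S hk (scale 3 z) (invThree z) (by simp [scale, invThree])]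
  obtain ⟨m, rfl⟩ := he
  have hm : (m + m) / 2 = m := by omega
  have h3 : ((√3 : ℝ) : ℂ) ^ (m + m) = 3 ^ m := by rw [← two_mul, pow_mul, sqrt_three_sq]
  rw [mul_pow, h3, hm]
  simp only [scale, mul_pow, pow_add]
  push_cast
  ring
end Fricke

/-! ### Taylor expansion of Eisenstein series in the disc coordinate -/

namespace Fricke
open UpperHalfPlane EisensteinSeries Filter Topology ComplexConjugate

lemma analyticOrderAt_le_of_hasSum {F : ℂ → ℂ} {a : ℕ → ℂ} {t : ℕ}
    (h : ∀ᶠ u in 𝓝 (0 : ℂ), HasSum (fun n => u ^ n * a n) (F u)) (ht : a t ≠ 0) :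
    analyticOrderAt F 0 ≤ t := by
  set p : FormalMultilinearSeries ℂ ℂ ℂ := FormalMultilinearSeries.ofScalars ℂ a with hp
  have hF : HasFPowerSeriesAt F p 0 := by
    rw [hasFPowerSeriesAt_iff]
    simpa [hp, FormalMultilinearSeries.coeff_ofScalars] using h
  have hpt : p t ≠ 0 := by
    intro h0
    apply ht
    rw [← FormalMultilinearSeries.coeff_ofScalars (𝕜 := ℂ) (p := a) (n := t), ← hp,
      FormalMultilinearSeries.coeff_eq_zero.2 h0]
  have hord : analyticOrderAt F 0 = p.order :=
    hF.analyticAt.analyticOrderAt_eq_natCast.2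
      ⟨_, (hF.has_fpower_series_iterate_dslope_fslope p.order).analyticAt,
        hF.iterate_dslope_fslope_ne_zero (fun h0 => hpt (by rw [h0]; rfl)),
        .of_forall hF.eq_pow_order_mul_iterate_dslope⟩
  rw [hord]
  exact_mod_cast Nat.sInf_le hpt

/-- The sum `∑ w̄^n w^(-(k+n))` over `w = c z + d` with `c`, `d` coprime. -/
noncomputable def coprimeSum (k n : ℕ) (z : ℂ) : ℂ :=
  ∑' x : gammaSet 1 1 0, conj (x.1 0 * z + x.1 1) ^ n / (x.1 0 * z + x.1 1) ^ (k + n)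

/-- The point with coordinate `u` in the unit disc, for the coordinate centred at `z`. -/
noncomputable def discPoint (z u : ℂ) : ℂ := (z - conj z * u) / (1 - u)

lemma linear_ne_zero (z : ℍ) (x : gammaSet 1 1 0) : (x.1 0 * z + x.1 1 : ℂ) ≠ 0 := by
  intro h
  have h1 := congrArg Complex.im h
  have h0 : x.1 0 = 0 := by simpa [z.im_ne_zero] using h1
  have h2 : x.1 1 = 0 := by simpa [h0] using h
  have := (mem_gammaSet_one x.1).1 x.2
  simp only [h0, h2] at this
  exact not_isCoprime_zero_zero this

lemma summable_norm_linear {k : ℕ} (hk : 3 ≤ k) (z : ℍ) :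
    Summable fun x : gammaSet 1 1 0 => ‖(x.1 0 * z + x.1 1 : ℂ)‖⁻¹ ^ k := by
  have := ((summable_norm_iff.2 (summable_eisSummand hk z)).subtype (gammaSet 1 1 0))
  refine this.congr fun x => ?_
  simp [eisSummand]

lemma E_eq_tsum {k : ℕ} (hk : 3 ≤ k) (z : ℍ) :
    ModularForm.E hk z = (1 / 2) * ∑' x : gammaSet 1 1 0, 1 / (x.1 0 * z + x.1 1 : ℂ) ^ k := by
  have : ModularForm.E hk z = (1 / 2) * eisensteinSeries (0 : Fin 2 → ZMod 1) k z := rfl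
  rw [this, eisensteinSeries]
  simp [eisSummand]

/-- Taylor expansion of the Eisenstein series in the disc coordinate centred at `z`. -/
lemma hasSum_E_disc {k : ℕ} (hk : 3 ≤ k) (z w : ℍ) {u : ℂ} (hu : ‖u‖ < 1)
    (hw : (w : ℂ) = discPoint z u) :
    HasSum (fun n : ℕ => u ^ n * (((n + (k - 1)).choose (k - 1) : ℂ) * (1 / 2 * coprimeSum k n z)))
      (1 / (1 - u) ^ k * ModularForm.E hk w) := by
  have hu1 : 1 - u ≠ 0 := by
    rintro h
    rw [sub_eq_zero] at h
    simp [← h] at hu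
  set G : ℕ × gammaSet 1 1 0 → ℂ := fun p => (((p.1 + (k - 1)).choose (k - 1) : ℂ) * u ^ p.1) *
    (conj (p.2.1 0 * (z : ℂ) + p.2.1 1) ^ p.1 / (p.2.1 0 * (z : ℂ) + p.2.1 1) ^ (k + p.1)) with hG
  -- The quotient `v̄/v` is unimodular, so the norm of each term is a product of a
  -- binomial-geometric term in `‖u‖` and `|v|^(-k)`. Absolute convergence of the double series
  -- justifies exchanging the sums.
  have hsum : Summable G := by
    have h1 := summable_choose_mul_geometric_of_norm_lt_one (k - 1) (r := ‖u‖) (by simpa using hu)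
    have h2 := summable_norm_linear hk z
    have h3 := h1.mul_of_nonneg h2 (fun n => by positivity) (fun x => by positivity)
    refine Summable.of_norm (h3.congr fun p => ?_)
    have h0 : ‖(p.2.1 0 * (z : ℂ) + p.2.1 1 : ℂ)‖ ≠ 0 := norm_ne_zero_iff.2 (linear_ne_zero z p.2)
    simp only [hG, norm_mul, norm_div, norm_pow, RCLike.norm_conj, Complex.norm_natCast]
    rw [pow_add, inv_pow]
    field_simp
  have hterm : ∀ x : gammaSet 1 1 0, HasSum (fun n => G (n, x))
      (1 / (1 - u) ^ k * (1 / (x.1 0 * w + x.1 1 : ℂ) ^ k)) := by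
    intro x
    set v : ℂ := x.1 0 * (z : ℂ) + x.1 1 with hv
    have hv0 : v ≠ 0 := linear_ne_zero z x
    have hr : ‖conj v / v * u‖ < 1 := by
      rw [norm_mul, norm_div, RCLike.norm_conj, div_self (norm_ne_zero_iff.2 hv0), one_mul]
      exact hu
    have h1 := (hasSum_choose_mul_geometric_of_norm_lt_one (k - 1) hr).mul_left (1 / v ^ k)
    rw [Nat.sub_add_cancel (by omega : 1 ≤ k)] at h1
    have hsub : 1 - conj v / v * u ≠ 0 := by
      intro h
      rw [sub_eq_zero] at h
      simp [← h] at hr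
    -- As `c`, `d` are real, `c w + d = (v - v̄ u)/(1 - u)`; its `-k`-th power is a negative
    -- binomial series in `(v̄/v) u`.
    have hxw : (x.1 0 * w + x.1 1 : ℂ) = v * (1 - conj v / v * u) / (1 - u) := by
      rw [hw, discPoint, hv]
      rw [← hv]
      field_simp
      simp only [hv, map_add, map_mul, map_intCast]
      ring
    convert! h1 using 1
    · ext n
      simp only [hG, ← hv]
      rw [mul_pow, div_pow, pow_add]
      field_simp
    · rw [hxw, div_pow, mul_pow]
      field_simp
  have hfib : ∀ n, HasSum (fun x => G (n, x))
      ((((n + (k - 1)).choose (k - 1) : ℂ) * u ^ n) * coprimeSum k n z) := by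
    intro n
    have := (hsum.prod_factor n).hasSum
    simp only [hG, tsum_mul_left] at this
    exact this
  have htot := hsum.hasSum.prod_fiberwise hfib
  have hval : ∑' p, G p = 1 / (1 - u) ^ k * (2 * ModularForm.E hk w) := by
    have hswap : HasSum (fun p : gammaSet 1 1 0 × ℕ => G p.swap) (∑' p, G p) :=
      (Equiv.prodComm _ _).hasSum_iff.2 hsum.hasSum
    rw [← (hswap.prod_fiberwise hterm).tsum_eq, tsum_mul_left, E_eq_tsum]
    ring
  rw [hval] at htot
  convert! htot.mul_left (1 / 2) using 1
  · ext n; ring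
  · ring
end Fricke

/-! ### Positivity of the lattice sums at `3z₀` -/

namespace Fricke
open UpperHalfPlane EisensteinSeries Filter Topology ComplexConjugate Finset

/-- A sum over `ℤ × ℤ` whose terms are `1` on `U ⊆ box 1` and small elsewhere has positive
real part. -/
lemma re_tsum_pos_of_box {a : ℤ × ℤ → ℂ} (hs : Summable a) {b τ : ℕ → ℝ} {U : Finset (ℤ × ℤ)}
    (hUbox : U ⊆ box 1) (h0 : a 0 = 0) (hU : ∀ p ∈ U, a p = 1)
    (h1 : ∀ p ∈ (box 1 : Finset (ℤ × ℤ)), p ∉ U → ‖a p‖ ≤ 1 / 9)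
    (hn : ∀ n ≥ 2, ∀ p ∈ (box n : Finset (ℤ × ℤ)), ‖a p‖ ≤ b n)
    (hτ : ∀ n ≥ 2, 8 * n * b n ≤ τ n - τ (n + 1)) (hτ0 : ∀ n ≥ 2, 0 ≤ τ n)
    (hlt : (8 - #U : ℝ) / 9 + τ 2 < #U) : 0 < (∑' p, a p).re := by
  set L : ℝ := #U - (8 - #U : ℝ) / 9 - τ 2 with hL
  have hbound : ∀ p : ℤ × ℤ, ∀ B : ℝ, ‖a p‖ ≤ B → -B ≤ (a p).re := fun p B h =>
    (abs_le.1 ((Complex.abs_re_le_norm _).trans h)).1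
  -- `box n` has `8n` points, so `hτ` says that box `n` costs at most `τ n - τ (n + 1)`. The losses
  -- telescope and total at most `τ 2`.
  have hpart : ∀ N : ℕ, L + τ (N + 2) ≤
      ∑ n ∈ range (N + 2), ∑ p ∈ (box n : Finset (ℤ × ℤ)), (a p).re := by
    intro N
    induction N with
    | zero =>
      rw [sum_range_succ, sum_range_one, box_zero, sum_singleton, h0, Complex.zero_re,
        ← sum_sdiff hUbox, sum_congr (s₁ := U) rfl (g := fun _ => (1 : ℝ))
          (fun p hp => by rw [hU p hp, Complex.one_re])]
      have hc : #((box 1 : Finset (ℤ × ℤ)) \ U) = (8 - #U : ℝ) := by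
        rw [cast_card_sdiff hUbox, Int.card_box one_ne_zero]
        norm_num
      have := card_nsmul_le_sum (box 1 \ U) (fun p => (a p).re) (-(1 / 9)) (fun p hp =>
        hbound p _ (h1 p (mem_sdiff.1 hp).1 (mem_sdiff.1 hp).2))
      rw [nsmul_eq_mul, hc] at this
      rw [sum_const, nsmul_eq_mul]
      simp only [zero_add, hL, mul_one] at this ⊢
      linarith
    | succ N ih =>
      rw [sum_range_succ]
      have := card_nsmul_le_sum (box (N + 2) : Finset (ℤ × ℤ)) (fun p => (a p).re) _ (fun p hp =>
        hbound p _ (hn (N + 2) (by omega) p hp))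
      rw [nsmul_eq_mul, Int.card_box (by omega)] at this
      have h2 := hτ (N + 2) (by omega)
      push_cast at this h2
      rw [show N + 1 + 2 = N + 2 + 1 by ring]
      linarith
  set S : ℕ → Finset (ℤ × ℤ) := fun N => (range (N + 2)).biUnion (fun n => box n) with hS
  have hmono : Monotone S := fun M N h => biUnion_subset_biUnion_of_subset_left _
    (range_mono (by omega))
  have hcov : ∀ p : ℤ × ℤ, ∃ N, p ∈ S N := fun p =>
    ⟨max p.1.natAbs p.2.natAbs, mem_biUnion.2 ⟨max p.1.natAbs p.2.natAbs,
      mem_range.2 (by omega), Int.mem_box.2 rfl⟩⟩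
  have hlim := (Complex.hasSum_re hs.hasSum).comp (tendsto_atTop_finset_of_monotone hmono hcov)
  have hge : L ≤ (∑' p, a p).re := by
    refine ge_of_tendsto' hlim fun N => ?_
    simp only [Function.comp, hS]
    rw [sum_biUnion]
    · have := hpart N
      have := hτ0 (N + 2) (by omega)
      linarith
    · intro m _ n _ hmn
      refine disjoint_left.2 fun p hp hp' => hmn ?_
      rw [← Int.mem_box.1 hp, ← Int.mem_box.1 hp']
  linarith

/-- The substitution `(x, y) ↦ (x, y + s x)`. -/
def shearEquiv (s : ℤ) : ℤ × ℤ ≃ (Fin 2 → ℤ) where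
  toFun p := ![p.1, p.2 + s * p.1]
  invFun v := (v 0, v 1 - s * v 0)
  left_inv p := by simp
  right_inv v := by ext i; fin_cases i <;> simp

open Classical in
/-- The terms of `coprimeSum` extended by zero, in sheared coordinates. -/
noncomputable def shearTerm (k n : ℕ) (z : ℂ) (s : ℤ) (p : ℤ × ℤ) : ℂ :=
  if IsCoprime p.1 p.2 then
    conj (p.1 * (z + s) + p.2 : ℂ) ^ n / (p.1 * (z + s) + p.2 : ℂ) ^ (k + n) else 0

/-- The conjugate power cancels in absolute value, leaving `|w|^(-k) ≤ |w|^(-4)`. -/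
lemma norm_term_le {k n : ℕ} (hk : 4 ≤ k) {w : ℂ} {B : ℝ} (hB : 1 ≤ B) (hw : B ≤ Complex.normSq w) :
    ‖conj w ^ n / w ^ (k + n)‖ ≤ 1 / B ^ 2 := by
  have h0 : 1 ≤ ‖w‖ := by
    rw [Complex.normSq_eq_norm_sq] at hw
    nlinarith [norm_nonneg w]
  rw [norm_div, norm_pow, norm_pow, RCLike.norm_conj, pow_add,
    div_mul_cancel_right₀ (by positivity), ← one_div]
  apply one_div_le_one_div_of_le (by positivity)
  calc B ^ 2 ≤ (‖w‖ ^ 2) ^ 2 := by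
        rw [← Complex.normSq_eq_norm_sq]; gcongr
    _ = ‖w‖ ^ 4 := by ring
    _ ≤ ‖w‖ ^ k := pow_le_pow_right₀ h0 hk

/-- On the unit circle `w̄ = w⁻¹`, so the term is `w^(-(k+2n))`. -/
lemma term_eq_one {k n N : ℕ} {w : ℂ} (hw : Complex.normSq w = 1) (hN : w ^ N = 1)
    (hdvd : N ∣ k + 2 * n) : conj w ^ n / w ^ (k + n) = 1 := by
  have hw0 : w ≠ 0 := by rintro rfl; simp at hw
  obtain ⟨m, hm⟩ := hdvd
  have hc : conj w * w = 1 := by rw [mul_comm, Complex.mul_conj, hw]; simp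
  have h1 : w ^ (k + 2 * n) = 1 := by rw [hm, pow_mul, hN, one_pow]
  rw [div_eq_one_iff_eq (pow_ne_zero _ hw0)]
  apply mul_right_cancel₀ (pow_ne_zero n hw0)
  rw [← mul_pow, hc, one_pow, ← h1]
  ring

lemma isCoprime_shear {x y s : ℤ} : IsCoprime x (y + s * x) ↔ IsCoprime x y :=
  IsCoprime.add_mul_right_right_iff

/-- The shear preserves coprimality and replaces `z` by `z + s`, which allows passing to a reduced
basis of the lattice. -/
lemma coprimeSum_eq_tsum_shear (k n : ℕ) (z : ℂ) (s : ℤ) :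
    coprimeSum k n z = ∑' p, shearTerm k n z s p := by
  have h := tsum_subtype (gammaSet 1 1 0)
    (fun x : Fin 2 → ℤ => conj (x 0 * z + x 1) ^ n / (x 0 * z + x 1) ^ (k + n))
  classical
  rw [coprimeSum, h, ← (shearEquiv s).tsum_eq]
  refine tsum_congr fun p => ?_
  rw [Set.indicator_apply, shearTerm]
  have hiff : shearEquiv s p ∈ gammaSet 1 1 0 ↔ IsCoprime p.1 p.2 := by
    rw [mem_gammaSet_one]
    exact isCoprime_shear
  have hlin : ((shearEquiv s p 0 : ℤ) * z + (shearEquiv s p 1 : ℤ) : ℂ) = p.1 * (z + s) + p.2 := by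
    simp [shearEquiv]; ring
  simp only [hiff, hlin]

lemma summable_shearTerm {k : ℕ} (hk : 3 ≤ k) (n : ℕ) (z : ℍ) (s : ℤ) :
    Summable (shearTerm k n z s) := by
  have h := (shearEquiv s).summable_iff.2 (summable_norm_iff.2 (summable_eisSummand hk z))
  refine Summable.of_norm_bounded h fun p => ?_
  have hlin : ((shearEquiv s p 0 : ℤ) * z + (shearEquiv s p 1 : ℤ) : ℂ) = p.1 * (z + s) + p.2 := by
    simp [shearEquiv]; ring
  simp only [Function.comp, eisSummand, hlin, shearTerm]
  split_ifs with hc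
  · rw [norm_div, norm_pow, norm_pow, RCLike.norm_conj, norm_zpow, zpow_neg, zpow_natCast, pow_add]
    rcases eq_or_ne ‖(p.1 * (z + s) + p.2 : ℂ)‖ 0 with h0 | h0
    · rw [h0, zero_pow (by omega : k ≠ 0)]
      simp
    · rw [div_mul_cancel_right₀ (pow_ne_zero _ h0)]
  · simp

lemma coprimeSum_re_pos_of_square {k n : ℕ} (hk : 4 ≤ k) (hdvd : 4 ∣ k + 2 * n) (z : ℍ)
    (hz : (z : ℂ) = (√3 : ℝ) * Complex.I) : 0 < (coprimeSum k n z).re := by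
  have hnorm : ∀ p : ℤ × ℤ, Complex.normSq (p.1 * ((z : ℂ) + (0 : ℤ)) + p.2) =
      3 * (p.1 : ℝ) ^ 2 + (p.2 : ℝ) ^ 2 := by
    intro p
    rw [hz, Complex.normSq_apply]
    simp
    ring_nf
    rw [Real.sq_sqrt (by norm_num)]
  have hle : ∀ p : ℤ × ℤ, ∀ B : ℝ, 1 ≤ B →
      (IsCoprime p.1 p.2 → B ≤ 3 * (p.1 : ℝ) ^ 2 + (p.2 : ℝ) ^ 2) →
      ‖shearTerm k n z 0 p‖ ≤ 1 / B ^ 2 := by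
    intro p B hB h
    rw [shearTerm]
    split_ifs with hc
    · exact norm_term_le hk hB (by rw [hnorm]; exact h hc)
    · rw [norm_zero]; positivity
  rw [coprimeSum_eq_tsum_shear k n z 0]
  -- The value of `τ` comes from `4/(n²-n+3) - 4/(n²+n+3) = 8n/((n²+3)² - n²)`, which is at least
  -- `8n · b n`. The final comparison is `6/9 + 4/5 < 2`.
  apply re_tsum_pos_of_box (summable_shearTerm (by omega) n z 0)
    (b := fun n => 1 / ((n : ℝ) ^ 2 + 3) ^ 2) (τ := fun n => 4 / ((n : ℝ) ^ 2 - n + 3))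
    (U := {(0, 1), (0, -1)})
  · decide
  · rw [shearTerm, if_neg (by simpa using not_isCoprime_zero_zero)]
  · intro p hp
    rw [shearTerm, if_pos]
    · refine term_eq_one (N := 4) ?_ ?_ hdvd
      · rw [hnorm]
        fin_cases hp <;> norm_num
      · fin_cases hp <;> norm_num
    · fin_cases hp
      · exact isCoprime_zero_left.2 isUnit_one
      · exact isCoprime_zero_left.2 isUnit_one.neg
  · intro p hp hpU
    rw [show (1 / 9 : ℝ) = 1 / 3 ^ 2 by norm_num]
    refine hle p 3 (by norm_num) fun _ => ?_
    obtain ⟨x, y⟩ := p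
    rw [Int.mem_box] at hp
    have : x ≠ 0 := by
      rintro rfl
      apply hpU
      have : y = 1 ∨ y = -1 := by simp at hp; omega
      rcases this with rfl | rfl <;> simp
    have h1 : 1 ≤ x ^ 2 := by nlinarith [sq_abs x, Int.one_le_abs this]
    have h2 : (1 : ℝ) ≤ (x : ℝ) ^ 2 := by exact_mod_cast h1
    nlinarith [sq_nonneg (y : ℝ)]
  · intro m hm p hp
    refine hle p _ (by nlinarith [sq_nonneg (m : ℝ)]) fun hc => ?_
    obtain ⟨x, y⟩ := p
    rw [Int.mem_box] at hp
    simp only at hp hc ⊢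
    -- Coprimality is essential here: the excluded points `(0, ±m)` have norm only `m²`, below the
    -- required `m² + 3`.
    have hx0 : x ≠ 0 := by
      rintro rfl
      have := Int.isUnit_iff_natAbs_eq.1 (isCoprime_zero_left.1 hc)
      simp at hp
      omega
    have hx : 1 ≤ |x| := Int.one_le_abs hx0
    have hxy : |x| = m ∨ |y| = m := by rw [Int.abs_eq_natAbs, Int.abs_eq_natAbs]; omega
    have hm' : (2 : ℤ) ≤ m := by exact_mod_cast hm
    have : (m : ℤ) ^ 2 + 3 ≤ 3 * x ^ 2 + y ^ 2 := by
      rw [← sq_abs x, ← sq_abs y]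
      rcases hxy with h | h
      · rw [h]; nlinarith [sq_nonneg |y|]
      · rw [h]; nlinarith
    exact_mod_cast this
  · intro m hm
    have hm' : (2 : ℝ) ≤ m := by exact_mod_cast hm
    push_cast
    have e1 : 0 < (m : ℝ) ^ 2 - m + 3 := by nlinarith
    have e2 : 0 < ((m : ℝ) + 1) ^ 2 - (m + 1) + 3 := by nlinarith
    rw [div_sub_div _ _ e1.ne' e2.ne', mul_one_div, div_le_div_iff₀ (by positivity) (by positivity)]
    nlinarith [pow_pos (by linarith : (0 : ℝ) < m) 3]
  · intro m hm
    have hm' : (2 : ℝ) ≤ m := by exact_mod_cast hm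
    have e1 : 0 < (m : ℝ) ^ 2 - m + 3 := by nlinarith
    positivity
  · rw [card_pair (by decide)]
    norm_num

lemma coprimeSum_re_pos_of_hexagonal {k n : ℕ} (hk : 4 ≤ k) (hdvd : 12 ∣ k + 2 * n) (z : ℍ)
    (hz : (z : ℂ) = -3 / 2 + (√3 : ℝ) / 2 * Complex.I) : 0 < (coprimeSum k n z).re := by
  have h3 := sqrt_three_sq
  -- The shear by `s = 1` turns `z` into a primitive cube root of unity; the six units of `ℤ[ω]` are
  -- then the vectors of norm 1.
  obtain ⟨ω, hω⟩ : ∃ ω : ℂ, ω = z + (1 : ℤ) := ⟨_, rfl⟩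
  have hω2 : ω ^ 2 + ω + 1 = 0 := by
    rw [hω, hz]
    push_cast
    linear_combination (1 / 4 : ℂ) * Complex.I ^ 2 * h3 + (3 / 4 : ℂ) * Complex.I_sq
  have hnorm : ∀ p : ℤ × ℤ, Complex.normSq (p.1 * ((z : ℂ) + (1 : ℤ)) + p.2) =
      (p.1 : ℝ) ^ 2 - p.1 * p.2 + (p.2 : ℝ) ^ 2 := by
    intro p
    rw [hz, Complex.normSq_apply]
    simp
    ring_nf
    rw [Real.sq_sqrt (by norm_num)]
    ring
  have hle : ∀ p : ℤ × ℤ, ∀ B : ℝ, 1 ≤ B →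
      B ≤ (p.1 : ℝ) ^ 2 - p.1 * p.2 + (p.2 : ℝ) ^ 2 →
      ‖shearTerm k n z 1 p‖ ≤ 1 / B ^ 2 := by
    intro p B hB h
    rw [shearTerm]
    split_ifs with hc
    · exact norm_term_le hk hB (by rw [hnorm]; exact h)
    · rw [norm_zero]; positivity
  rw [coprimeSum_eq_tsum_shear k n z 1]
  -- Here `x² - xy + y² ≥ (3/4) max(|x|, |y|)²`, so box `n` costs at most `(128/9)/n³`, which is at
  -- most `(128/9)/(n(n²-1)) = τ n - τ (n + 1)`. The final comparison is `2/9 + 32/9 < 6`.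
  apply re_tsum_pos_of_box (summable_shearTerm (by omega) n z 1)
    (b := fun n => 1 / (3 / 4 * (n : ℝ) ^ 2) ^ 2) (τ := fun n => 64 / 9 / ((n : ℝ) * (n - 1)))
    (U := {(0, 1), (0, -1), (1, 0), (-1, 0), (1, 1), (-1, -1)})
  · decide
  · rw [shearTerm, if_neg (by simpa using not_isCoprime_zero_zero)]
  · intro p hp
    rw [shearTerm, if_pos]
    · refine term_eq_one (N := 12) ?_ ?_ hdvd
      · rw [hnorm]
        fin_cases hp <;> norm_num
      · rw [← hω]
        have h1 : ω ^ 3 = 1 := by linear_combination (ω - 1) * hω2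
        have h2 : ω + 1 = -ω ^ 2 := by linear_combination hω2
        have h12 : ω ^ 12 = 1 := by rw [show 12 = 3 * 4 by norm_num, pow_mul, h1, one_pow]
        have h24 : (-ω ^ 2) ^ 12 = 1 := by
          rw [Even.neg_pow (by decide), ← pow_mul, mul_comm, pow_mul, h12, one_pow]
        fin_cases hp
        · simp
        · norm_num
        · simpa using h12
        · simpa [Even.neg_pow (by decide : Even 12)] using h12
        · simpa [h2] using h24
        · rw [← h24, ← h2, ← Even.neg_pow (by decide : Even 12) (ω + 1)]
          push_cast
          ring
    · fin_cases hp
      · exact isCoprime_zero_left.2 isUnit_one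
      · exact isCoprime_zero_left.2 isUnit_one.neg
      · exact isCoprime_zero_right.2 isUnit_one
      · exact isCoprime_zero_right.2 isUnit_one.neg
      · exact isCoprime_one_left
      · exact isCoprime_one_left.neg_neg
  · intro p hp hpU
    rw [show (1 / 9 : ℝ) = 1 / 3 ^ 2 by norm_num]
    refine hle p 3 (by norm_num) ?_
    have key : ∀ p ∈ (box 1 : Finset (ℤ × ℤ)),
        p ∉ ({(0, 1), (0, -1), (1, 0), (-1, 0), (1, 1), (-1, -1)} : Finset (ℤ × ℤ)) →
        3 ≤ p.1 ^ 2 - p.1 * p.2 + p.2 ^ 2 := by decide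
    exact_mod_cast key p hp hpU
  · intro m hm p hp
    have hm' : (2 : ℝ) ≤ m := by exact_mod_cast hm
    refine hle p _ (by nlinarith) ?_
    obtain ⟨x, y⟩ := p
    rw [Int.mem_box] at hp
    simp only at hp ⊢
    have hxy : |x| = m ∨ |y| = m := by rw [Int.abs_eq_natAbs, Int.abs_eq_natAbs]; omega
    have hxy' : (x : ℝ) ^ 2 = m ^ 2 ∨ (y : ℝ) ^ 2 = m ^ 2 := by
      refine hxy.imp (fun h => ?_) (fun h => ?_) <;>
      · rw [← sq_abs, ← Int.cast_abs, h, Int.cast_natCast]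
    rcases hxy' with h | h
    · nlinarith [sq_nonneg ((y : ℝ) - x / 2)]
    · nlinarith [sq_nonneg ((x : ℝ) - y / 2)]
  · intro m hm
    have hm' : (2 : ℝ) ≤ m := by exact_mod_cast hm
    have e0 : 0 < (m : ℝ) - 1 := by linarith
    push_cast
    rw [add_sub_cancel_right, show 8 * (m : ℝ) * (1 / (3 / 4 * (m : ℝ) ^ 2) ^ 2) =
      128 / 9 / (m : ℝ) ^ 3 by field_simp; norm_num, div_sub_div _ _ (by positivity) (by positivity),
      div_le_div_iff₀ (by positivity) (by positivity)]
    nlinarith [pow_pos (by linarith : (0 : ℝ) < m) 3]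
  · intro m hm
    have hm' : (2 : ℝ) ≤ m := by exact_mod_cast hm
    have e0 : 0 < (m : ℝ) - 1 := by linarith
    positivity
  · rw [show #({(0, 1), (0, -1), (1, 0), (-1, 0), (1, 1), (-1, -1)} : Finset (ℤ × ℤ)) = 6 by decide]
    norm_num
end Fricke

/-! ### Exact order of `E*` at a fixed point -/

namespace Fricke
open UpperHalfPlane EisensteinSeries Filter Topology ComplexConjugate

/-- Exchanging the two coordinates of a coprime pair. -/
def gammaSetSwap : gammaSet 1 1 0 ≃ gammaSet 1 1 0 where
  toFun x := ⟨![x.1 1, x.1 0], (mem_gammaSet_one _).2 ((mem_gammaSet_one _).1 x.2).symm⟩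
  invFun x := ⟨![x.1 1, x.1 0], (mem_gammaSet_one _).2 ((mem_gammaSet_one _).1 x.2).symm⟩
  left_inv x := by ext i; fin_cases i <;> rfl
  right_inv x := by ext i; fin_cases i <;> rfl

/-- Because `3 z z̄ = 1`, we have `d z + c = z · conj(3 c z + d)`: swapping the pair relates the
lattices of `z` and `3z`. The powers of `z` that come out combine to `(√3 z)^(k+2n)`, which is 1,
and leave the factor `√3^k`. -/
lemma coprimeSum_eq_conj {k n : ℕ} {z : ℂ} (hz : 3 * Complex.normSq z = 1)
    (hpow : (((√3 : ℝ) : ℂ) * z) ^ (k + 2 * n) = 1) :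
    coprimeSum k n z = ((√3 : ℝ) : ℂ) ^ k * conj (coprimeSum k n (3 * z)) := by
  have h3 := sqrt_three_sq
  have hzz : 3 * (z * conj z) = 1 := by
    rw [Complex.mul_conj]
    exact_mod_cast hz
  have hz0 : z ≠ 0 := by rintro rfl; simp at hz
  rw [coprimeSum, ← gammaSetSwap.tsum_eq, coprimeSum, Complex.conj_tsum, ← tsum_mul_left]
  refine tsum_congr fun x => ?_
  obtain ⟨v, hv⟩ : ∃ v : ℂ, v = x.1 0 * (3 * z) + x.1 1 := ⟨_, rfl⟩
  have h1 : ((gammaSetSwap x).1 0 * z + (gammaSetSwap x).1 1 : ℂ) = z * conj v := by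
    simp only [gammaSetSwap, Equiv.coe_fn_mk, Matrix.cons_val_zero, Matrix.cons_val_one, hv,
      map_add, map_mul, map_intCast, map_ofNat]
    linear_combination -(x.1 0 : ℂ) * hzz
  rw [h1, ← hv]
  have hzc : conj z = 1 / (3 * z) := by
    rw [eq_div_iff (by simpa using hz0)]
    linear_combination hzz
  simp only [map_mul, map_pow, map_div₀, Complex.conj_conj, hzc]
  rcases eq_or_ne (conj v) 0 with hc | hc
  · rcases Nat.eq_zero_or_pos (k + n) with h | h
    · obtain ⟨rfl, rfl⟩ : k = 0 ∧ n = 0 := by omega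
      simp
    · simp [hc, zero_pow h.ne']
  · rw [mul_pow, mul_pow, div_pow, one_pow, mul_div_assoc', div_eq_div_iff
      (mul_ne_zero (pow_ne_zero _ hz0) (pow_ne_zero _ hc)) (pow_ne_zero _ hc)]
    have hp : ((√3 : ℝ) : ℂ) ^ k * 3 ^ n * (z ^ (k + n) * z ^ n) = 1 := by
      rw [← hpow, mul_pow, pow_add ((√3 : ℝ) : ℂ), pow_mul ((√3 : ℝ) : ℂ) 2 n, h3]; ring
    rw [mul_pow 3 z]
    field_simp
    linear_combination -v ^ n * hp

lemma analyticAt_modularForm {Γ : Subgroup (GL (Fin 2) ℝ)} {k : ℤ} (f : ModularForm Γ k) (z : ℍ) :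
    AnalyticAt ℂ (f ∘ ofComplex) z :=
  (UpperHalfPlane.mdifferentiable_iff.1 f.holo').analyticAt (isOpen_upperHalfPlaneSet.mem_nhds z.im_pos)

lemma analyticAt_EStar {k : ℕ} (hk : 3 ≤ k) (z : ℍ) :
    AnalyticAt ℂ (EStar hk 3 ∘ ofComplex) z := by
  have h1 := analyticAt_modularForm (ModularForm.E hk) z
  have h2 : AnalyticAt ℂ (fun w : ℂ => (ModularForm.E hk ∘ ofComplex) (3 * w)) z :=
    AnalyticAt.fun_comp (f := fun w : ℂ => 3 * w) (analyticAt_modularForm (ModularForm.E hk) (scale 3 z))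
      (by fun_prop)
  have h3 := (analyticAt_const (v := 1 / ((3 : ℂ) ^ (k / 2) + 1)) (x := (z : ℂ))).mul
    (((analyticAt_const (v := (3 : ℂ) ^ (k / 2))).mul h2).add h1)
  refine h3.congr ?_
  filter_upwards [isOpen_upperHalfPlaneSet.mem_nhds z.im_pos] with w hw
  have e : ofComplex (3 * w) = scale 3 ⟨w, hw⟩ := by
    rw [← ofComplex_apply (scale 3 ⟨w, hw⟩)]
    rfl
  simp [Function.comp, EStar, e, ofComplex_apply_of_im_pos hw]

lemma ord_EStar_le {k t : ℕ} (he : Even k) (z₀ : ℍ)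
    (hz₀ : 3 * Complex.normSq (z₀ : ℂ) = 1)
    (hpow : (((√3 : ℝ) : ℂ) * z₀) ^ (k + 2 * t) = 1)
    (hpos : 0 < (coprimeSum k t (scale 3 z₀)).re) (hk3 : 3 ≤ k) :
    ord z₀ (EStar hk3 3) ≤ t := by
  set g : ℂ → ℂ := EStar hk3 3 ∘ ofComplex with hgdef
  have hg : AnalyticAt ℂ g z₀ := analyticAt_EStar hk3 z₀
  change analyticOrderAt g z₀ ≤ t
  by_contra hcon
  have hle : ((t + 1 : ℕ) : ℕ∞) ≤ analyticOrderAt g z₀ := by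
    push_cast
    exact Order.add_one_le_of_lt (not_le.1 hcon)
  obtain ⟨h, hh, hgh⟩ := (natCast_le_analyticOrderAt hg).1 hle
  have hd0 : discPoint z₀ 0 = z₀ := by simp [discPoint]
  have hdan : AnalyticAt ℂ (discPoint (z₀ : ℂ)) 0 := by
    unfold discPoint
    fun_prop (disch := simp)
  have hdt : Tendsto (discPoint (z₀ : ℂ)) (𝓝 0) (𝓝 (z₀ : ℂ)) := by
    simpa only [hd0] using hdan.continuousAt.tendsto
  have hball : ∀ᶠ u in 𝓝 (0 : ℂ), ‖u‖ < 1 := by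
    filter_upwards [Metric.ball_mem_nhds (0 : ℂ) one_pos] with u hu
    simpa using hu
  have hne : ∀ u : ℂ, ‖u‖ < 1 → 1 - u ≠ 0 := by
    intro u hu h
    rw [sub_eq_zero] at h
    simp [← h] at hu
  set F : ℂ → ℂ := fun u => 1 / (1 - u) ^ k * g (discPoint z₀ u) with hF
  have hupper : ∀ᶠ u in 𝓝 (0 : ℂ), 0 < (discPoint z₀ u).im :=
    hdt.eventually (isOpen_upperHalfPlaneSet.mem_nhds z₀.im_pos)
  -- Since `discPoint (3z) u = 3 · discPoint z u`, the same `u` serves as coordinate for both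
  -- summands of `E*`.
  have hsum : ∀ᶠ u in 𝓝 (0 : ℂ), HasSum (fun n => u ^ n *
      (1 / ((3 : ℂ) ^ (k / 2) + 1) * (((n + (k - 1)).choose (k - 1) : ℂ) * (1 / 2)) *
        ((3 : ℂ) ^ (k / 2) * coprimeSum k n (scale 3 z₀) + coprimeSum k n z₀))) (F u) := by
    filter_upwards [hball, hupper] with u hu hw
    have h1 := hasSum_E_disc hk3 z₀ ⟨_, hw⟩ hu rfl
    have h2 := hasSum_E_disc hk3 (scale 3 z₀) (scale 3 ⟨_, hw⟩) hu (by
      simp only [scale, discPoint, map_mul, Nat.cast_ofNat, map_ofNat]; ring)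
    convert! ((h2.mul_left ((3 : ℂ) ^ (k / 2))).add h1).mul_left (1 / ((3 : ℂ) ^ (k / 2) + 1)) using 1
    · ext n; ring
    · simp only [hF, hgdef, Function.comp, EStar, ofComplex_apply_of_im_pos hw]
      push_cast
      ring
  have hFan : AnalyticAt ℂ F 0 := by
    have h1 : AnalyticAt ℂ (fun u => g (discPoint (z₀ : ℂ) u)) 0 :=
      AnalyticAt.fun_comp (by rwa [hd0]) hdan
    have h2 : AnalyticAt ℂ (fun u : ℂ => 1 / (1 - u) ^ k) 0 := by
      fun_prop (disch := simp)
    exact h2.mul h1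
  -- The coordinate satisfies `discPoint z₀ u - z₀ = u (z₀ - z̄₀)/(1 - u)`, so a zero of order at
  -- least `t + 1` at `z₀` persists at `u = 0`.
  have hFge : ((t + 1 : ℕ) : ℕ∞) ≤ analyticOrderAt F 0 := by
    refine (natCast_le_analyticOrderAt hFan).2
      ⟨fun u => 1 / (1 - u) ^ k * ((((z₀ : ℂ) - conj (z₀ : ℂ)) / (1 - u)) ^ (t + 1) *
        h (discPoint z₀ u)), ?_, ?_⟩
    · have h1 : AnalyticAt ℂ (fun u => h (discPoint (z₀ : ℂ) u)) 0 :=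
        AnalyticAt.fun_comp (by rwa [hd0]) hdan
      have h2 : AnalyticAt ℂ (fun u : ℂ => 1 / (1 - u) ^ k) 0 := by
        fun_prop (disch := simp)
      have h3 : AnalyticAt ℂ
          (fun u : ℂ => (((z₀ : ℂ) - conj (z₀ : ℂ)) / (1 - u)) ^ (t + 1)) 0 := by
        fun_prop (disch := simp)
      exact h2.mul (h3.mul h1)
    · filter_upwards [hdt.eventually hgh, hball] with u hu hu1
      have h1u := hne u hu1
      have : discPoint z₀ u - z₀ = u * (((z₀ : ℂ) - conj (z₀ : ℂ)) / (1 - u)) := by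
        rw [discPoint]; field_simp; ring
      simp only [hF, hu, this, smul_eq_mul, sub_zero, mul_pow]
      ring
  have hcoeff : 1 / ((3 : ℂ) ^ (k / 2) + 1) * (((t + (k - 1)).choose (k - 1) : ℂ) * (1 / 2)) *
        ((3 : ℂ) ^ (k / 2) * coprimeSum k t (scale 3 z₀) + coprimeSum k t z₀) ≠ 0 := by
    have hsc : ((scale 3 z₀ : ℍ) : ℂ) = 3 * z₀ := by simp [scale]
    have h3 : ((√3 : ℝ) : ℂ) ^ k = 3 ^ (k / 2) := by
      rw [← sqrt_three_sq, ← pow_mul, Nat.mul_div_cancel' he.two_dvd]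
    -- The bracket becomes `3^(k/2)` times a number plus its conjugate, hence twice a positive real
    -- part.
    rw [coprimeSum_eq_conj hz₀ hpow, h3, ← hsc, ← mul_add, Complex.add_conj]
    have hch : ((t + (k - 1)).choose (k - 1) : ℂ) ≠ 0 := by
      exact_mod_cast (Nat.choose_pos (by omega)).ne'
    have h31 : (3 : ℂ) ^ (k / 2) + 1 ≠ 0 := by exact_mod_cast (Nat.succ_ne_zero (3 ^ (k / 2)))
    have hre : ((2 * (coprimeSum k t (scale 3 z₀)).re : ℝ) : ℂ) ≠ 0 := by
      exact_mod_cast (by positivity)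
    exact mul_ne_zero (mul_ne_zero (one_div_ne_zero h31) (mul_ne_zero hch (by norm_num)))
      (mul_ne_zero (pow_ne_zero _ (by norm_num)) hre)
  have := hFge.trans (analyticOrderAt_le_of_hasSum hsum hcoeff)
  have : t + 1 ≤ t := by exact_mod_cast this
  omega

/-- The order of vanishing of a function with the transformation behaviour of a form for `Γ₀*(3)`
at a fixed point `z₀` of `z ↦ -1 / (3 z) - a`, when finite, is determined modulo the stabilizer. -/
lemma ord_eq_top_or_dvd {f : ℍ → ℂ} {k N a : ℕ} {z₀ : ℍ}
    (hT : ∀ z : ℍ, f ((1 : ℝ) +ᵥ z) = f z)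
    (hW : ∀ z : ℍ, f (invThree z) = (((√3 : ℝ) : ℂ) * z) ^ k * f z)
    (hf : AnalyticAt ℂ (f ∘ ofComplex) z₀) (hfix : -1 / (3 * (z₀ : ℂ)) - a = z₀)
    (hN : IsPrimitiveRoot (((√3 : ℝ) : ℂ) * z₀) N) :
    ord z₀ f = ⊤ ∨ ∃ m : ℕ, ord z₀ f = m ∧ N ∣ k + 2 * m := by
  refine or_iff_not_imp_left.2 fun h => ?_
  obtain ⟨m, hm⟩ := ENat.ne_top_iff_exists.1 h
  exact ⟨m, hm.symm, (hN.pow_eq_one_iff_dvd _).1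
    (pow_eq_one_of_transform z₀.ne_zero hfix hf (transform_of_invariant hT hW z₀) hm.symm)⟩

lemma ord_smul {z : ℍ} {f : ℍ → ℂ} (hf : AnalyticAt ℂ (f ∘ ofComplex) z) {a : ℂ} (ha : a ≠ 0) :
    ord z (a • f) = ord z f := by
  have h : analyticOrderAt (fun _ : ℂ => a) (z : ℂ) = 0 :=
    analyticOrderAt_eq_zero.2 (Or.inr ha)
  have := analyticOrderAt_smul (f := fun _ : ℂ => a) (g := f ∘ ofComplex) (z₀ := (z : ℂ))
    analyticAt_const hf
  rw [h, zero_add] at this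
  exact this

lemma ord_at_fixedPoint {k t N a : ℕ} (he : Even k) {z₀ : ℍ}
    (hfix : -1 / (3 * (z₀ : ℂ)) - a = z₀) (hN : IsPrimitiveRoot (((√3 : ℝ) : ℂ) * z₀) N)
    (hz₀ : 3 * Complex.normSq (z₀ : ℂ) = 1) (ht : 2 * t < N) (htk : N ∣ k + 2 * t)
    (hpos : 0 < (coprimeSum k t (scale 3 z₀)).re) (hk3 : 3 ≤ k) :
    (∀ f : M k 3, (t : ℕ∞) ≤ ord z₀ f) ∧
      ∀ c : ℂ, c ≠ 0 → ord z₀ (c • EStar hk3 3) = t := by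
  have hmin : ∀ m : ℕ, N ∣ k + 2 * m → t ≤ m := by
    intro m hm
    -- If `m < t`, then `N` divides `2t - 2m`, which lies strictly between `0` and `N`.
    by_contra hlt
    have h1 : N ∣ 2 * t - 2 * m := by
      have := Nat.dvd_sub htk hm
      rwa [Nat.add_sub_add_left] at this
    have := Nat.le_of_dvd (by omega) h1
    omega
  have hge : ∀ f : ℍ → ℂ, (ord z₀ f = ⊤ ∨ ∃ m : ℕ, ord z₀ f = m ∧ N ∣ k + 2 * m) →
      (t : ℕ∞) ≤ ord z₀ f := by
    rintro f (h | ⟨m, h, hm⟩)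
    · rw [h]; exact le_top
    · rw [h]; exact_mod_cast hmin m hm
  refine ⟨fun f => hge f (ord_eq_top_or_dvd (M_vadd_one f) (M_invThree f)
    (analyticAt_modularForm f z₀) hfix hN), fun c hc => ?_⟩
  rw [ord_smul (analyticAt_EStar hk3 z₀) hc]
  exact le_antisymm
    (ord_EStar_le he z₀ hz₀ ((hN.pow_eq_one_iff_dvd _).2 htk) hpos hk3)
    (hge _ (ord_eq_top_or_dvd (EStar_vadd_one hk3) (EStar_invThree hk3 he)
      (analyticAt_EStar hk3 z₀) hfix hN))

/-! ### The two fixed points `i/√3` and `ρ₃` -/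

lemma sqrt_three_mul_iDivSqrtThree :
    ((√3 : ℝ) : ℂ) * iDivSqrtThree = Complex.I := by
  have := sqrt_three_ne_zero
  simp only [iDivSqrtThree]
  field_simp

lemma sqrt_three_mul_rhoThree : ((√3 : ℝ) : ℂ) * rhoThree =
    Complex.exp (2 * Real.pi * Complex.I * ((5 : ℕ) / (12 : ℕ))) := by
  have := sqrt_three_ne_zero
  simp only [rhoThree]
  field_simp
  congr 1
  push_cast
  ring

lemma exp_five_pi_div_six : Complex.exp (2 * Real.pi * Complex.I * ((5 : ℕ) / (12 : ℕ))) =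
    -(√3 : ℝ) / 2 + Complex.I / 2 := by
  have h : (2 * Real.pi * Complex.I * ((5 : ℕ) / (12 : ℕ)) : ℂ) =
      ((Real.pi - Real.pi / 6 : ℝ) : ℂ) * Complex.I := by
    push_cast; ring
  rw [h, Complex.exp_mul_I, ← Complex.ofReal_cos, ← Complex.ofReal_sin, Real.cos_pi_sub,
    Real.sin_pi_sub, Real.cos_pi_div_six, Real.sin_pi_div_six]
  push_cast
  ring

lemma rhoThree_eq : (rhoThree : ℂ) = -1 / 2 + (√3 : ℝ) / 6 * Complex.I := by
  have h := sqrt_three_mul_rhoThree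
  rw [exp_five_pi_div_six] at h
  apply mul_left_cancel₀ sqrt_three_ne_zero
  rw [h]
  linear_combination -Complex.I / 6 * sqrt_three_sq

lemma iDivSqrtThree_eq : (iDivSqrtThree : ℂ) = (√3 : ℝ) / 3 * Complex.I := by
  apply mul_left_cancel₀ sqrt_three_ne_zero
  rw [sqrt_three_mul_iDivSqrtThree]
  linear_combination -Complex.I / 3 * sqrt_three_sq

lemma isPrimitiveRoot_I : IsPrimitiveRoot Complex.I 4 := by
  have := Complex.isPrimitiveRoot_exp_of_coprime 1 4 (by norm_num) (by norm_num)
  rwa [show (2 * Real.pi * Complex.I * ((1 : ℕ) / (4 : ℕ)) : ℂ) = Real.pi / 2 * Complex.I by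
    push_cast; ring, Complex.exp_pi_div_two_mul_I] at this

lemma normSq_of_sqrt_three_mul {z : ℂ} (h : ‖((√3 : ℝ) : ℂ) * z‖ = 1) :
    3 * Complex.normSq z = 1 := by
  have h2 := congrArg (· ^ 2) h
  simp only [norm_mul, mul_pow, Complex.norm_real, Real.norm_eq_abs, sq_abs, one_pow] at h2
  rwa [Real.sq_sqrt (by norm_num), ← Complex.normSq_eq_norm_sq] at h2

end Fricke

theorem mainTheorem8 (k : ℕ) (hk : 4 ≤ k) (hk_even : Even k)
    (s : ℕ) (hs : s ∈ ({0, 1} : Set ℕ)) (hsk : 2 * (s : ℤ) ≡ (k : ℤ) [ZMOD 4])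
    (t : ℕ) (ht : t ∈ ({0, 1, 2, 3, 4, 5} : Set ℕ)) (htk : -2 * (t : ℤ) ≡ (k : ℤ) [ZMOD 12]) :
    (∀ f : Fricke.M k 3,
      (s : ℕ∞) ≤ Fricke.ord Fricke.iDivSqrtThree f ∧ (t : ℕ∞) ≤ Fricke.ord Fricke.rhoThree f) ∧
    (∀ a : ℂ, a ≠ 0 →
      Fricke.ord Fricke.iDivSqrtThree (a • Fricke.EStar (k := k) (by omega) 3) = (s : ℕ∞) ∧
      Fricke.ord Fricke.rhoThree (a • Fricke.EStar (k := k) (by omega) 3) = (t : ℕ∞)) := by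
  have hk3 : 3 ≤ k := by omega
  have hs' : 2 * s < 4 := by rcases hs with rfl | rfl <;> norm_num
  have ht' : 2 * t < 12 := by rcases ht with rfl | rfl | rfl | rfl | rfl | rfl <;> norm_num
  have hsd : 4 ∣ k + 2 * s := by have := hsk.dvd; omega
  have htd : 12 ∣ k + 2 * t := by have := htk.dvd; omega
  have h3 := Fricke.sqrt_three_sq
  have hI := Fricke.sqrt_three_mul_iDivSqrtThree
  have hρ := Fricke.sqrt_three_mul_rhoThree
  have hNI : IsPrimitiveRoot (((√3 : ℝ) : ℂ) * Fricke.iDivSqrtThree) 4 := by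
    rw [hI]; exact Fricke.isPrimitiveRoot_I
  have hNρ : IsPrimitiveRoot (((√3 : ℝ) : ℂ) * Fricke.rhoThree) 12 := by
    rw [hρ]; exact Complex.isPrimitiveRoot_exp_of_coprime 5 12 (by norm_num) (by norm_num)
  -- The fixed points of `z ↦ -1/(3z) - a` are the roots of `3z² + 3az + 1`; `a = 0` gives `i/√3`
  -- and `a = 1` gives `ρ₃`.
  have hfix : ∀ z : UpperHalfPlane, ∀ a : ℕ, 3 * (z : ℂ) ^ 2 + 3 * a * z + 1 = 0 →
      -1 / (3 * (z : ℂ)) - a = z := by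
    intro z a h
    have := z.ne_zero
    field_simp
    linear_combination -h
  obtain ⟨i1, i2⟩ := Fricke.ord_at_fixedPoint (t := s) (a := 0) hk_even
    (hfix _ 0 (by
      rw [Fricke.iDivSqrtThree_eq]
      push_cast
      linear_combination (1 / 3 : ℂ) * Complex.I ^ 2 * h3 + Complex.I_sq)) hNI
    (Fricke.normSq_of_sqrt_three_mul (hNI.norm'_eq_one (by norm_num))) hs' hsd
    (Fricke.coprimeSum_re_pos_of_square hk hsd _ (by
      simp only [Fricke.scale, Fricke.iDivSqrtThree_eq]
      push_cast
      ring)) hk3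
  obtain ⟨r1, r2⟩ := Fricke.ord_at_fixedPoint (t := t) (a := 1) hk_even
    (hfix _ 1 (by
      rw [Fricke.rhoThree_eq]
      push_cast
      linear_combination (1 / 12 : ℂ) * Complex.I ^ 2 * h3 + (1 / 4 : ℂ) * Complex.I_sq)) hNρ
    (Fricke.normSq_of_sqrt_three_mul (hNρ.norm'_eq_one (by norm_num))) ht' htd
    (Fricke.coprimeSum_re_pos_of_hexagonal hk htd _ (by
      simp only [Fricke.scale, Fricke.rhoThree_eq]
      push_cast
      ring)) hk3
  exact ⟨fun f => ⟨i1 f, r1 f⟩, fun a ha => ⟨i2 a ha, r2 a ha⟩⟩
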